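/- Let $k$ be a field, and let $(H,\Delta)$ be a Hopf algebra over $k$ with unit $1$ and counit $\varepsilon$. Assume that $H$ has \emph{invariant functionals}, that is, non-zero linear functionals $\varphi,\psi\colon H\to k$ with $(\mathrm{id}\otimes\varphi)\Delta(h)=\varphi(h)1$ and $(\psi\otimes\mathrm{id})\Delta(h)=\psi(h)1$ for all $h\in H$. Algebras are associative $k$-algebras, not necessarily unital; modules over them are $k$-vector spaces with a $k$-bilinear associative action; comodules are coassociative and counital. Let $(A,\alpha)$ be a (right) $H$-comodule algebra: a $k$-algebra $A$ with an algebra homomorphism $\alpha\colon A\to A\otimes H$ that makes $A$ a right $H$-comodule. Put $A^\alpha=\{a\in A\mid \alpha(a)=a\otimes 1\}$. Let $I$ be a set and let $k_I=\bigoplus_{i\in I}k$ be the algebra of finitely supported functions $I\to k$ with the pointwise product. Suppose that $(A,\alpha)$ is an \emph{$I$-Galois object}: the map \[ A\otimes_{A^\alpha}A\to A\otimes H,\qquad a\otimes b\mapsto (a\otimes 1)\alpha(b) \] is bijective, and $A^\alpha\cong k_I$ as $k$-algebras. Here $A\otimes_{A^\alpha}A$ is the quotient of $A\otimes_kA$ by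 the span of all $ac\otimes b-a\otimes cb$ with $a,b\in A$ and $c\in A^\alpha$. Then the following hold. (1) $AA^\alpha=A^\alpha A=A$, where products of subspaces denote the linear spans of products of elements. (2) $A$ has \emph{$H$-coinvariant local units}: for every finite subset $F\subseteq A$ there is $e\in A^\alpha$ with $ea=a=ae$ for all $a\in F$. (3) $(A,\alpha)$ is \emph{equivariantly absolutely semisimple}: every unital $H$-equivariant $A$-module $V$ is isomorphic, as an $H$-equivariant $A$-module, to a (possibly empty, possibly infinite) direct sum of equivariantly absolutely simple $H$-equivariant $A$-modules. Here an \emph{$H$-equivariant $A$-module} is an $A$-module $V$ with a right $H$-comodule structure $\delta\colon V\to V\otimes H$ such that $\delta(av)=\alpha(a)\delta(v)$ for all $a\in A$, $v\in V$. It is \emph{unital} if $V$ is the span of the elements $av$ with $a\in A$, $v\in V$. It is \emph{equivariantly simple} if $AV\ne\{0\}$ and $\{0\}$ and $V$ are its only subspaces $W$ with $AW\subseteq W$ and $\delta(W)\subseteq W\otimes H$. It is \emph{equivariantly absolutely simple} if, for every field extension $k\subseteq K$, $K\otimes_k V$ is equivariantly simple as a $K\otimes_k H$-equivariant $K\otimes_k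 A$-module over the field $K$. -/

import Mathlib

open scoped TensorProduct DirectSum

universe u v w x y z

noncomputable section

namespace HopfGalois

/-! ### Invariant functionals and comodules -/

section Hopf

variable (k : Type u) [Field k] (H : Type y) [Ring H] [HopfAlgebra k H]

/-- `(id ⊗ φ) Δ(h) = φ(h) 1` for all `h`. -/
def IsLeftInvariant (φ : H →ₗ[k] k) : Prop :=
  ∀ h : H, TensorProduct.rid k H (φ.lTensor H (Coalgebra.comul (R := k) h)) = φ h • (1 : H)

/-- `(ψ ⊗ id) Δ(h) = ψ(h) 1` for all `h`. -/
def IsRightInvariant (ψ : H →ₗ[k] k) : Prop :=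
  ∀ h : H, TensorProduct.lid k H (ψ.rTensor H (Coalgebra.comul (R := k) h)) = ψ h • (1 : H)

/-- The Hopf algebra `H` has non-zero left and right invariant functionals. -/
def HasInvariantFunctionals : Prop :=
  (∃ φ : H →ₗ[k] k, φ ≠ 0 ∧ IsLeftInvariant k H φ) ∧
    ∃ ψ : H →ₗ[k] k, ψ ≠ 0 ∧ IsRightInvariant k H ψ

variable {k H}

/-- `δ : V → V ⊗ H` is a (coassociative, counital) right `H`-comodule structure on `V`. -/
structure IsComodule {V : Type x} [AddCommGroup V] [Module k V] (δ : V →ₗ[k] V ⊗[k] H) :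
    Prop where
  coassoc : ∀ a : V, TensorProduct.assoc k V H H (δ.rTensor H (δ a)) =
    (Coalgebra.comul (R := k) (A := H)).lTensor V (δ a)
  counit : ∀ a : V,
    TensorProduct.rid k V ((Coalgebra.counit (R := k) (A := H)).lTensor V (δ a)) = a

end Hopf

/-! ### Comodule algebras, which need not be unital -/

section ComoduleAlgebra

variable (k : Type u) [Field k] (H : Type y) [Ring H] [HopfAlgebra k H]
  (A : Type v) [NonUnitalRing A] [Module k A] [IsScalarTower k A A] [SMulCommClass k A A]

/-- A coaction of `H` on the (not necessarily unital) algebra `A`: an algebra homomorphism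
`α : A → A ⊗ H` that makes `A` into a right `H`-comodule. -/
structure Coaction where
  toHom : A →ₙₐ[k] A ⊗[k] H
  isComodule : IsComodule (toHom : A →ₗ[k] A ⊗[k] H)

variable {k H A}

namespace Coaction

variable (α : Coaction k H A)

/-- The algebra of coinvariants `A^α = {a | α(a) = a ⊗ 1}`. -/
def coinvariants : NonUnitalSubalgebra k A where
  carrier := {a | α.toHom a = a ⊗ₜ[k] (1 : H)}
  add_mem' {a b} ha hb := by
    simp only [Set.mem_ofPred_eq] at ha hb ⊢
    rw [map_add, ha, hb, TensorProduct.add_tmul]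
  zero_mem' := by simp
  mul_mem' {a b} ha hb := by
    simp only [Set.mem_ofPred_eq] at ha hb ⊢
    rw [map_mul, ha, hb, Algebra.TensorProduct.tmul_mul_tmul, one_mul]
  smul_mem' c a ha := by
    simp only [Set.mem_ofPred_eq] at ha ⊢
    rw [map_smul, ha, TensorProduct.smul_tmul']

/-- The relations `ac ⊗ b - a ⊗ cb`, with `c ∈ A^α`, that cut `A ⊗_{A^α} A` out of `A ⊗_k A`. -/
def balancedRelations : Submodule k (A ⊗[k] A) :=
  Submodule.span k {t | ∃ a b : A, ∃ c ∈ α.coinvariants,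
    t = (a * c) ⊗ₜ[k] b - a ⊗ₜ[k] (c * b)}

/-- The tensor product `A ⊗_{A^α} A`. -/
abbrev BalancedTensor : Type v := (A ⊗[k] A) ⧸ α.balancedRelations

/-- The linear map `A ⊗ (A ⊗ H) → A ⊗ H`, `a ⊗ (b ⊗ h) ↦ ab ⊗ h`; for `t ∈ A ⊗ H` the image of
`a ⊗ t` is what one writes as `(a ⊗ 1) t`. -/
def leftMulMap (k : Type u) [Field k] (H : Type y) [Ring H] [HopfAlgebra k H]
    (A : Type v) [NonUnitalRing A] [Module k A] [IsScalarTower k A A] [SMulCommClass k A A] :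
    A ⊗[k] (A ⊗[k] H) →ₗ[k] A ⊗[k] H :=
  (LinearMap.mul' k A).rTensor H ∘ₗ (TensorProduct.assoc k A A H).symm.toLinearMap

/-- The map `A ⊗_k A → A ⊗ H`, `a ⊗ b ↦ (a ⊗ 1) α(b)`. -/
def preGaloisMap : A ⊗[k] A →ₗ[k] A ⊗[k] H :=
  leftMulMap k H A ∘ₗ (α.toHom : A →ₗ[k] A ⊗[k] H).lTensor A

theorem preGaloisMap_tmul (a b : A) :
    α.preGaloisMap (a ⊗ₜ[k] b) = (a ⊗ₜ[k] (1 : H)) * α.toHom b := by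
  change leftMulMap k H A (a ⊗ₜ[k] (α.toHom b)) = _
  induction α.toHom b using TensorProduct.induction_on with
  | zero => simp
  | tmul c h => simp [leftMulMap]
  | add s t hs ht => rw [TensorProduct.tmul_add, map_add, hs, ht, mul_add]

/-- The Galois map `can : A ⊗_{A^α} A → A ⊗ H`, `a ⊗ b ↦ (a ⊗ 1) α(b)`. -/
def galoisMap : α.BalancedTensor →ₗ[k] A ⊗[k] H :=
  α.balancedRelations.liftQ α.preGaloisMap <| by
    rw [balancedRelations, Submodule.span_le]
    rintro _ ⟨a, b, c, hc, rfl⟩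
    have hc' : α.toHom c = c ⊗ₜ[k] (1 : H) := hc
    simp only [SetLike.mem_coe, LinearMap.mem_ker, map_sub, preGaloisMap_tmul, map_mul, hc']
    rw [← mul_assoc, Algebra.TensorProduct.tmul_mul_tmul, one_mul, sub_self]

/-- `(A, α)` is a Galois coaction: the Galois map is bijective. -/
def IsGalois : Prop := Function.Bijective α.galoisMap

/-- `(A, α)` is an `I`-Galois object: a Galois coaction with `A^α ≅ k_I` as algebras, where `k_I`
is the algebra `I →₀ k` of finitely supported functions with pointwise product. -/
def IsGaloisObject (I : Type z) : Prop :=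
  α.IsGalois ∧ ∃ f : α.coinvariants →ₙₐ[k] (I →₀ k), Function.Bijective f

/-- `A` has `H`-coinvariant local units: each finite subset of `A` has a common two-sided unit
in `A^α`. -/
def HasCoinvariantLocalUnits : Prop :=
  ∀ s : Finset A, ∃ e ∈ α.coinvariants, ∀ a ∈ s, e * a = a ∧ a * e = a

end Coaction

end ComoduleAlgebra

/-! ### Equivariant modules -/

section EquivariantModule

variable {k : Type u} [Field k] {H : Type y} [Ring H] [HopfAlgebra k H]
  {A : Type v} [NonUnitalRing A] [Module k A] [IsScalarTower k A A] [SMulCommClass k A A]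

/-- The action of `A ⊗ H` on `V ⊗ H` given by `(a ⊗ h) (v ⊗ g) = av ⊗ hg`. -/
def tensorAct {A : Type v} [NonUnitalRing A] [Module k A]
    (H : Type y) [Ring H] [HopfAlgebra k H] {V : Type x} [AddCommGroup V] [Module k V]
    (act : A →ₗ[k] V →ₗ[k] V) : A ⊗[k] H →ₗ[k] V ⊗[k] H →ₗ[k] V ⊗[k] H :=
  TensorProduct.map₂ act (LinearMap.mul k H)

theorem tensorAct_tmul {A : Type v} [NonUnitalRing A] [Module k A] {V : Type x} [AddCommGroup V] [Module k V]
    (act : A →ₗ[k] V →ₗ[k] V) (a : A) (h : H) (t : V) (g : H) :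
    tensorAct H act (a ⊗ₜ[k] h) (t ⊗ₜ[k] g) = act a t ⊗ₜ[k] (h * g) := by
  simp [tensorAct]

/-- The structure of an `H`-equivariant `A`-module on the vector space `V`: a module structure
over the (not necessarily unital) algebra `A` and an `H`-comodule structure `δ` such that
`δ(av) = α(a) δ(v)`. -/
structure EquivariantModule (α : Coaction k H A) (V : Type x) [AddCommGroup V] [Module k V] where
  act : A →ₙₐ[k] Module.End k V
  coact : V →ₗ[k] V ⊗[k] H
  isComodule : IsComodule coact
  equivariant : ∀ (a : A) (t : V),
    coact (act a t) = tensorAct H (act : A →ₗ[k] Module.End k V) (α.toHom a) (coact t)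

/-- Simplicity over a field `K` of a space `V` with an action of `A` and a coaction of `H`:
`AV ≠ 0`, and `0` and `V` are the only subspaces `W` with `AW ⊆ W` and `δ(W) ⊆ W ⊗ H`. -/
def IsEquivariantlySimple {K : Type w} [Field K] {A H V : Type*} [AddCommGroup A] [Module K A]
    [AddCommGroup H] [Module K H] [AddCommGroup V] [Module K V]
    (act : A →ₗ[K] V →ₗ[K] V) (δ : V →ₗ[K] V ⊗[K] H) : Prop :=
  (∃ a t, act a t ≠ 0) ∧
    ∀ W : Submodule K V, (∀ a, ∀ t ∈ W, act a t ∈ W) →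
      (∀ t ∈ W, δ t ∈ LinearMap.range (W.subtype.rTensor H)) → W = ⊥ ∨ W = ⊤

/-- Extension of scalars of an action: `K ⊗ A` acts on `K ⊗ V` by
`(c ⊗ a) (d ⊗ v) = cd ⊗ av`. -/
def baseChangeAct {A : Type v} [NonUnitalRing A] [Module k A] (K : Type w) [Field K] [Algebra k K]
    {V : Type x} [AddCommGroup V] [Module k V] (act : A →ₗ[k] V →ₗ[k] V) :
    K ⊗[k] A →ₗ[K] K ⊗[k] V →ₗ[K] K ⊗[k] V :=
  (LinearMap.baseChangeHom k K V V ∘ₗ act).liftBaseChange K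

theorem baseChangeAct_tmul {A : Type v} [NonUnitalRing A] [Module k A]
    (K : Type w) [Field K] [Algebra k K] {V : Type x} [AddCommGroup V] [Module k V]
    (act : A →ₗ[k] V →ₗ[k] V) (c d : K) (a : A) (t : V) :
    baseChangeAct K act (c ⊗ₜ[k] a) (d ⊗ₜ[k] t) = (c * d) ⊗ₜ[k] act a t := by
  simp [baseChangeAct, TensorProduct.smul_tmul']

/-- Extension of scalars of a coaction: if `δ(v) = ∑ vᵢ ⊗ hᵢ` then
`c ⊗ v ↦ ∑ (c ⊗ vᵢ) ⊗ (1 ⊗ hᵢ)`. -/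
def baseChangeCoact (K : Type w) [Field K] [Algebra k K] {V : Type x} [AddCommGroup V]
    [Module k V] (δ : V →ₗ[k] V ⊗[k] H) :
    K ⊗[k] V →ₗ[K] (K ⊗[k] V) ⊗[K] (K ⊗[k] H) :=
  (TensorProduct.AlgebraTensorModule.distribBaseChange k K V H).toLinearMap ∘ₗ δ.baseChange K

theorem baseChangeCoact_tmul (K : Type w) [Field K] [Algebra k K] {V : Type x} [AddCommGroup V]
    [Module k V] (δ : V →ₗ[k] V ⊗[k] H) (c : K) (t : V) {n : ℕ} (p : Fin n → V) (q : Fin n → H)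
    (ht : δ t = ∑ i, p i ⊗ₜ[k] q i) :
    baseChangeCoact K δ (c ⊗ₜ[k] t) = ∑ i, (c ⊗ₜ[k] p i) ⊗ₜ[K] ((1 : K) ⊗ₜ[k] q i) := by
  simp [baseChangeCoact, ht, TensorProduct.tmul_sum]

namespace EquivariantModule

variable {α : Coaction k H A}

/-- `V` is a unital module: `V = AV`. -/
def IsUnital {V : Type x} [AddCommGroup V] [Module k V] (M : EquivariantModule α V) : Prop :=
  Submodule.span k {r : V | ∃ (a : A) (t : V), r = M.act a t} = ⊤

/-- `V` is equivariantly absolutely simple: for every field extension `K` of `k`, `K ⊗ V` is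
simple as a `K ⊗ H`-equivariant `K ⊗ A`-module. The universe of `K` is at least that of `k`. -/
def IsAbsolutelySimple {V : Type x} [AddCommGroup V] [Module k V]
    (M : EquivariantModule α V) : Prop :=
  ∀ (K : Type (max u w)) [Field K] [Algebra k K],
    IsEquivariantlySimple (K := K)
      (baseChangeAct K (M.act : A →ₗ[k] Module.End k V)) (baseChangeCoact K M.coact)

/-- `f` is a morphism of equivariant modules. -/
structure IsHom {V : Type x} [AddCommGroup V] [Module k V] {W : Type z} [AddCommGroup W]
    [Module k W] (M : EquivariantModule α V) (N : EquivariantModule α W) (f : V →ₗ[k] W) :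
    Prop where
  map_act : ∀ (a : A) (t : V), f (M.act a t) = N.act a (f t)
  map_coact : ∀ t : V, N.coact (f t) = f.rTensor H (M.coact t)

/-- `V` is equivariantly absolutely semisimple: it is isomorphic to a direct sum, possibly empty
or infinite, of equivariantly absolutely simple modules `Vᵢ`. A linear isomorphism `e` onto
`⨁ Vᵢ` is an isomorphism of equivariant modules exactly when all its components are morphisms. -/
def IsAbsolutelySemisimple {V : Type x} [AddCommGroup V] [Module k V]
    (M : EquivariantModule α V) : Prop :=
  ∃ (ι : Type x) (S : ι → Type x) (_ : ∀ i, AddCommGroup (S i)) (_ : ∀ i, Module k (S i))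
    (N : ∀ i, EquivariantModule α (S i)) (e : V ≃ₗ[k] ⨁ i, S i),
    (∀ i, IsAbsolutelySimple.{u, v, w} (N i)) ∧
      ∀ i, IsHom M (N i) (DirectSum.component k ι S i ∘ₗ e.toLinearMap)

end EquivariantModule

/-- `(A, α)` is equivariantly absolutely semisimple: every unital `H`-equivariant `A`-module is
equivariantly absolutely semisimple. -/
def Coaction.IsEquivariantlyAbsolutelySemisimple (α : Coaction k H A) : Prop :=
  ∀ (V : Type x) [AddCommGroup V] [Module k V] (M : EquivariantModule α V),
    M.IsUnital → EquivariantModule.IsAbsolutelySemisimple.{u, v, w} M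

end EquivariantModule

end HopfGalois

end

noncomputable section

/-! Fix a non-zero left invariant functional `φ` and put E(v) = (id ⊗ φ)δ(v), for comodules in
general and for `A` itself. By left invariance E takes coinvariant values. The forms φ(gh) and φ(hg)
are non-degenerate on `H` and the antipode S is bijective, so on the finitely many legs of a given
tensor the counit equals some φ(g ·), and also some φ(· S(g)).

Applying id ⊗ φ to (a ⊗ 1)α(b) gives aE(b). Since the Galois map is surjective, a ⊗ g with φ(g) ≠ 0
is a sum of such tensors, so AA^α = A. The map a ⊗ h ↦ α(a)(1 ⊗ S(h)) sends (a ⊗ 1)α(b) to α(a)(b ⊗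
1), whose slice is E(a)b; this gives A^αA = A. Units of finite sets in A^α ≅ k_I are then local
units for all of `A`.

For a module the same device gives at ∈ span A E(At) (`act_mem_span`). In a unital module, E(At) = 0
therefore forces t = 0, and V is generated by its coinvariant vectors. The minimal idempotents of
k_I split these into weight vectors, on which A^α acts by scalars. For a weight vector t, E(At) lies
on the line kt, since E(at) = E(a)t. Hence a non-zero submodule of At meets the line of t and is
everything, also after extending scalars. Likewise E maps a relation among the spaces At, with t in
a linearly independent set of weight vectors, to a relation among the t themselves. So V is the
direct sum of the At, with t in a maximal independent set of weight vectors. -/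

namespace HopfGalois

/-! ### Slices of tensors along functionals. -/

section Slice

variable {k : Type*} [Field k] {H : Type*} [AddCommGroup H] [Module k H]
  {V : Type*} [AddCommGroup V] [Module k V] {W : Type*} [AddCommGroup W] [Module k W]

/-- The slice map `id ⊗ θ : V ⊗ H → V`. -/
def slice (V : Type*) [AddCommGroup V] [Module k V] (θ : H →ₗ[k] k) : V ⊗[k] H →ₗ[k] V :=
  (TensorProduct.rid k V).toLinearMap ∘ₗ θ.lTensor V

@[simp] theorem slice_tmul (θ : H →ₗ[k] k) (t : V) (h : H) : slice V θ (t ⊗ₜ[k] h) = θ h • t := by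
  simp [slice]

@[simp] theorem slice_zero : slice V (0 : H →ₗ[k] k) = 0 := by
  ext; simp

theorem slice_rTensor (θ : H →ₗ[k] k) (f : V →ₗ[k] W) (t : V ⊗[k] H) :
    slice W θ (f.rTensor H t) = f (slice V θ t) := by
  induction t using TensorProduct.induction_on with
  | zero => simp
  | tmul => simp
  | add s t hs ht => simp [hs, ht]

/-- A tensor annihilated by the slices along a set of functionals is a finite sum of pure tensors
whose right legs are annihilated by these functionals. -/
theorem exists_sum_of_slice_eq_zero {ι : Type*} (θ : ι → H →ₗ[k] k) (t : V ⊗[k] H)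
    (ht : ∀ i, slice V (θ i) t = 0) :
    ∃ (n : ℕ) (p : Fin n → V) (q : Fin n → H),
      t = ∑ j, p j ⊗ₜ[k] q j ∧ ∀ i j, θ i (q j) = 0 := by
  -- With basis vectors as left legs, a vanishing slice is a linear relation among them, so every
  -- coefficient θ(q) vanishes separately.
  let b := Module.Basis.ofVectorSpace k V
  obtain ⟨c, rfl⟩ := TensorProduct.eq_repr_basis_left b t
  let e := c.support.equivFin.symm
  refine ⟨_, fun j => b (e j), fun j => c (e j), ?_, ?_⟩
  · rw [Finsupp.sum, ← Finset.sum_coe_sort, ← Equiv.sum_comp e]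
  · intro i j
    have h := ht i
    simp only [Finsupp.sum, map_sum, slice_tmul] at h
    exact linearIndependent_iff'.1 b.linearIndependent _ _ h _ (e j).2

theorem exists_eq_sum_tmul (t : V ⊗[k] H) :
    ∃ (n : ℕ) (p : Fin n → V) (q : Fin n → H), t = ∑ j, p j ⊗ₜ[k] q j := by
  obtain ⟨n, p, q, h, -⟩ := exists_sum_of_slice_eq_zero (ι := Empty) (fun i => i.elim) t
    (fun i => i.elim)
  exact ⟨n, p, q, h⟩

/-- A separating linear family of functionals interpolates every functional on a finite set of
vectors. -/
theorem exists_slice_eq {G : Type*} [AddCommGroup G] [Module k G] (θ : G →ₗ[k] H →ₗ[k] k)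
    (hθ : ∀ c, (∀ g, θ g c = 0) → c = 0) (ω : H →ₗ[k] k) (t : V ⊗[k] H) :
    ∃ g, slice V (θ g) t = slice V ω t := by
  obtain ⟨n, p, q, rfl⟩ := exists_eq_sum_tmul t
  let C := Submodule.span k (Set.range q)
  have : FiniteDimensional k C := FiniteDimensional.span_of_finite k (Set.finite_range q)
  let B : G →ₗ[k] C →ₗ[k] k := (LinearMap.lcomp k k C.subtype) ∘ₗ θ
  -- The right legs span a finite-dimensional C, where a family of functionals that separates points
  -- exhausts the dual.
  have hB : Function.Surjective B := by
    rw [← LinearMap.flip_injective_iff₂, injective_iff_map_eq_zero]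
    intro c hc
    ext
    exact hθ c fun g => LinearMap.congr_fun hc g
  obtain ⟨g, hg⟩ := hB (ω ∘ₗ C.subtype)
  refine ⟨g, ?_⟩
  simp only [map_sum, slice_tmul]
  refine Finset.sum_congr rfl fun i _ => ?_
  rw [show θ g (q i) = ω (q i) from
    LinearMap.congr_fun hg ⟨q i, Submodule.subset_span ⟨i, rfl⟩⟩]

end Slice

/-! ### Faithfulness of the invariant functional and bijectivity of the antipode. -/

section Antipode

variable {k : Type u} [Field k] {H : Type y} [Ring H] [HopfAlgebra k H]

open Coalgebra HopfAlgebra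

theorem IsLeftInvariant.slice_comul {φ : H →ₗ[k] k} (hφ : IsLeftInvariant k H φ) (h : H) :
    slice H φ (comul (R := k) h) = φ h • (1 : H) := hφ h

theorem slice_counit_comul (h : H) : slice H (counit (R := k)) (comul (R := k) h) = h := by
  simp [slice]

theorem slice_tmul_one_mul (φ : H →ₗ[k] k) (c : H) (t : H ⊗[k] H) :
    slice H φ ((c ⊗ₜ[k] 1) * t) = c * slice H φ t := by
  induction t using TensorProduct.induction_on with
  | zero => simp
  | tmul => simp
  | add s t hs ht => simp [mul_add, hs, ht]

theorem slice_mul_tmul_one (φ : H →ₗ[k] k) (c : H) (t : H ⊗[k] H) :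
    slice H φ (t * (c ⊗ₜ[k] 1)) = slice H φ t * c := by
  induction t using TensorProduct.induction_on with
  | zero => simp
  | tmul => simp
  | add s t hs ht => simp [add_mul, hs, ht]

theorem slice_mul_one_tmul (φ : H →ₗ[k] k) (c : H) (t : H ⊗[k] H) :
    slice H φ (t * ((1 : H) ⊗ₜ[k] c)) = slice H (φ ∘ₗ LinearMap.mulRight k c) t := by
  induction t using TensorProduct.induction_on with
  | zero => simp
  | tmul => simp
  | add s t hs ht => simp [add_mul, hs, ht]

theorem slice_one_tmul_mul (φ : H →ₗ[k] k) (c : H) (t : H ⊗[k] H) :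
    slice H φ (((1 : H) ⊗ₜ[k] c) * t) = slice H (φ ∘ₗ LinearMap.mulLeft k c) t := by
  induction t using TensorProduct.induction_on with
  | zero => simp
  | tmul => simp
  | add s t hs ht => simp [mul_add, hs, ht]

/-- `∑ b₁ φ(a b₂) = S(∑ a₁ φ(a₂ b))` for a left invariant functional `φ`. -/
theorem IsLeftInvariant.slice_mulLeft_comul {φ : H →ₗ[k] k} (hφ : IsLeftInvariant k H φ)
    (a b : H) :
    slice H (φ ∘ₗ LinearMap.mulLeft k a) (comul (R := k) b) =
      antipode k (slice H (φ ∘ₗ LinearMap.mulRight k b) (comul (R := k) a)) := by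
  let Q : H ⊗[k] H →ₗ[k] H := slice H φ ∘ₗ LinearMap.mulRight k (comul (R := k) b)
  -- F(x ⊗ y ⊗ z) = ∑ S(x) y b₁ φ(z b₂), evaluated on a₁ ⊗ a₂ ⊗ a₃ in two ways: invariance of `φ`
  -- collapses the last two legs, the antipode axiom the first two.
  let F : H ⊗[k] (H ⊗[k] H) →ₗ[k] H := LinearMap.mul' k H ∘ₗ TensorProduct.map (antipode k) Q
  let r := ℛ k a
  have key := congrArg F (sum_tmul_tmul_eq r (fun i => ℛ k (r.left i)) (fun i => ℛ k (r.right i)))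
  simp only [map_sum] at key
  have h1 (i) : ∑ j ∈ (ℛ k (r.right i)).index, F (r.left i ⊗ₜ
      ((ℛ k (r.right i)).left j ⊗ₜ (ℛ k (r.right i)).right j)) =
      antipode k (φ (r.right i * b) • r.left i) := by
    rw [← map_sum, ← TensorProduct.tmul_sum, (ℛ k (r.right i)).eq]
    simp only [F, Q, LinearMap.comp_apply, TensorProduct.map_tmul, LinearMap.mul'_apply,
      LinearMap.mulRight_apply, ← Bialgebra.comul_mul, hφ.slice_comul]
    simp
  have h2 (i) : ∑ j ∈ (ℛ k (r.left i)).index, F ((ℛ k (r.left i)).left j ⊗ₜ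
      ((ℛ k (r.left i)).right j ⊗ₜ r.right i)) =
      slice H (φ ∘ₗ LinearMap.mulLeft k (counit (R := k) (r.left i) • r.right i))
        (comul (R := k) b) := by
    have : ∀ x y : H, F (x ⊗ₜ (y ⊗ₜ r.right i)) = (antipode k x * y) *
        slice H (φ ∘ₗ LinearMap.mulLeft k (r.right i)) (comul (R := k) b) := by
      intro x y
      simp only [F, Q, LinearMap.comp_apply, TensorProduct.map_tmul, LinearMap.mul'_apply,
        LinearMap.mulRight_apply]
      rw [show y ⊗ₜ[k] r.right i = (y ⊗ₜ[k] 1) * (1 ⊗ₜ[k] r.right i) by simp, mul_assoc,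
        slice_tmul_one_mul, slice_one_tmul_mul, mul_assoc]
    simp only [this]
    rw [← Finset.sum_mul, sum_antipode_mul_eq_smul, smul_mul_assoc, one_mul,
      ← slice_one_tmul_mul, ← slice_one_tmul_mul, TensorProduct.tmul_smul, smul_mul_assoc, map_smul]
  simp only [h1, h2] at key
  simp only [← slice_one_tmul_mul] at key ⊢
  rw [← map_sum, ← map_sum, ← Finset.sum_mul, ← TensorProduct.tmul_sum, sum_counit_smul r] at key
  rw [key, ← r.eq]
  simp

/-- `∑ Δ(S(h₁)) (h₂ ⊗ 1) = 1 ⊗ S(h)`. -/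
theorem sum_comul_antipode_mul (h : H) :
    ∑ i ∈ (ℛ k h).index, comul (R := k) (antipode k ((ℛ k h).left i)) *
      ((ℛ k h).right i ⊗ₜ[k] 1) = 1 ⊗ₜ[k] antipode k h := by
  -- p(x ⊗ y) = Δ(x)(1 ⊗ S(y)), so p(Δ(x)) = x ⊗ 1. Then ∑ Δ(S(h₁))(h₂ ⊗ 1) = ∑ Δ(S(h₁)h₂)(1 ⊗
  -- S(h₃)), which collapses.
  let p : H ⊗[k] H →ₗ[k] H ⊗[k] H := LinearMap.mul' k (H ⊗[k] H) ∘ₗ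
    TensorProduct.map (comul (R := k)) (TensorProduct.mk k H H 1 ∘ₗ antipode k)
  have hp (x : H) : p (comul (R := k) x) = x ⊗ₜ 1 := by
    let r := ℛ k x
    let G : H ⊗[k] (H ⊗[k] H) →ₗ[k] H ⊗[k] H :=
      (LinearMap.mul' k H ∘ₗ (antipode k).lTensor H).lTensor H
    have key := congrArg G
      (sum_tmul_tmul_eq r (fun i => ℛ k (r.left i)) (fun i => ℛ k (r.right i)))
    simp only [map_sum] at key
    have h1 (i) : ∑ j ∈ (ℛ k (r.right i)).index, G (r.left i ⊗ₜ
        ((ℛ k (r.right i)).left j ⊗ₜ (ℛ k (r.right i)).right j)) =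
        (counit (R := k) (r.right i) • r.left i) ⊗ₜ 1 := by
      simp only [G, LinearMap.lTensor_tmul, LinearMap.comp_apply, LinearMap.mul'_apply]
      rw [← TensorProduct.tmul_sum, sum_mul_antipode_eq_smul, TensorProduct.smul_tmul]
    have h2 (i) : ∑ j ∈ (ℛ k (r.left i)).index, G ((ℛ k (r.left i)).left j ⊗ₜ
        ((ℛ k (r.left i)).right j ⊗ₜ r.right i)) = p (r.left i ⊗ₜ r.right i) := by
      simp only [p, LinearMap.comp_apply, TensorProduct.map_tmul, LinearMap.mul'_apply]
      conv_rhs => rw [← (ℛ k (r.left i)).eq]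
      simp [G, Finset.sum_mul]
    simp only [h1, h2] at key
    rw [← map_sum, r.eq, ← TensorProduct.sum_tmul] at key
    rw [key]
    congr 1
    conv_rhs => rw [← slice_counit_comul (k := k) x, ← r.eq]
    simp
  let r := ℛ k h
  let F : H ⊗[k] (H ⊗[k] H) →ₗ[k] H ⊗[k] H := LinearMap.mul' k (H ⊗[k] H) ∘ₗ
    TensorProduct.map (comul (R := k) ∘ₗ antipode k) p
  have key := congrArg F (sum_tmul_tmul_eq r (fun i => ℛ k (r.left i)) (fun i => ℛ k (r.right i)))
  simp only [map_sum] at key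
  have h1 (i) : ∑ j ∈ (ℛ k (r.right i)).index, F (r.left i ⊗ₜ
      ((ℛ k (r.right i)).left j ⊗ₜ (ℛ k (r.right i)).right j)) =
      comul (R := k) (antipode k (r.left i)) * (r.right i ⊗ₜ[k] 1) := by
    rw [← map_sum, ← TensorProduct.tmul_sum, (ℛ k (r.right i)).eq]
    simp [F, hp]
  have h2 (i) : ∑ j ∈ (ℛ k (r.left i)).index, F ((ℛ k (r.left i)).left j ⊗ₜ
      ((ℛ k (r.left i)).right j ⊗ₜ r.right i)) =
      1 ⊗ₜ antipode k (counit (R := k) (r.left i) • r.right i) := by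
    simp only [F, p, LinearMap.comp_apply, TensorProduct.map_tmul, LinearMap.mul'_apply,
      ← mul_assoc, ← Bialgebra.comul_mul]
    rw [← Finset.sum_mul, ← map_sum, sum_antipode_mul_eq_smul]
    simp [Algebra.TensorProduct.one_def]
  simp only [h1, h2] at key
  rw [← key, ← TensorProduct.tmul_sum, ← map_sum, sum_counit_smul r]

/-- `∑ a₁ φ(a₂ S(h)) = ∑ φ(a S(h₁)) h₂` for a left invariant functional `φ`. -/
theorem IsLeftInvariant.slice_mulRight_antipode {φ : H →ₗ[k] k} (hφ : IsLeftInvariant k H φ)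
    (a h : H) :
    slice H (φ ∘ₗ LinearMap.mulRight k (antipode k h)) (comul (R := k) a) =
      slice H (φ ∘ₗ LinearMap.mulLeft k a ∘ₗ antipode k)
        (TensorProduct.comm k H H (comul (R := k) h)) := by
  rw [← slice_mul_one_tmul, ← sum_comul_antipode_mul, Finset.mul_sum]
  simp only [← mul_assoc, ← Bialgebra.comul_mul, map_sum, slice_mul_tmul_one, hφ.slice_comul]
  conv_rhs => rw [← (ℛ k h).eq]
  simp

/-- The radical N = {a | φ(Ha) = 0} satisfies Δ(N) ⊆ H ⊗ N, because ∑ a₁φ(ca₂) is S of a slice along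
φ(· a) = 0. Evaluating φ(g ·) on ε(a)1 = ∑ S(a₁)a₂ with φ(g) ≠ 0 shows that ε kills N, and then a =
∑ a₁ε(a₂) = 0. -/
theorem IsLeftInvariant.eq_zero_of_forall_mul_left {φ : H →ₗ[k] k} (hφ : IsLeftInvariant k H φ)
    (h0 : φ ≠ 0) {a : H} (ha : ∀ b, φ (b * a) = 0) : a = 0 := by
  obtain ⟨g, hg⟩ : ∃ g, φ g ≠ 0 := by
    by_contra! h
    exact h0 (LinearMap.ext h)
  have key (a : H) (ha : ∀ b, φ (b * a) = 0) : ∃ (n : ℕ) (p q : Fin n → H),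
      comul (R := k) a = ∑ j, p j ⊗ₜ[k] q j ∧ ∀ i j, φ (i * q j) = 0 := by
    refine exists_sum_of_slice_eq_zero (fun c => φ ∘ₗ LinearMap.mulLeft k c) _ fun c => ?_
    have : φ ∘ₗ LinearMap.mulRight k a = 0 := by
      ext b
      simp [ha]
    rw [hφ.slice_mulLeft_comul, this, slice_zero]
    simp
  have hε (a : H) (ha : ∀ b, φ (b * a) = 0) : counit (R := k) a = 0 := by
    obtain ⟨n, p, q, h, hq⟩ := key a ha
    have h1 := mul_antipode_rTensor_comul_apply (R := k) a
    rw [h] at h1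
    have h2 := congrArg (fun x => φ (g * x)) h1
    simpa [Finset.mul_sum, ← mul_assoc, hq, Algebra.algebraMap_eq_smul_one, hg] using h2.symm
  obtain ⟨n, p, q, h, hq⟩ := key a ha
  have h1 := slice_counit_comul (k := k) a
  rw [h] at h1
  rw [← h1]
  simp [hε _ (fun b => hq b _)]

/-- By faithfulness some φ(a ·) agrees with ε on the right legs of Δ(b). Then b = ∑ b₁φ(ab₂), which
`slice_mulLeft_comul` exhibits as a value of S. -/
theorem IsLeftInvariant.antipode_surjective {φ : H →ₗ[k] k} (hφ : IsLeftInvariant k H φ)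
    (h0 : φ ≠ 0) : Function.Surjective (antipode k (A := H)) := by
  intro b
  obtain ⟨a, ha⟩ := exists_slice_eq (LinearMap.compr₂ (LinearMap.mul k H) φ)
    (fun c hc => hφ.eq_zero_of_forall_mul_left h0 hc) (counit (R := k)) (comul (R := k) b)
  rw [slice_counit_comul] at ha
  exact ⟨_, (hφ.slice_mulLeft_comul a b).symm.trans ha⟩

/-- If S(h) = 0, then ∑ φ(aS(h₁))h₂ = 0 for all a, so Δ(h) can be written with left legs in the
kernel of S by faithfulness. Since ε ∘ S = ε, the counit kills these legs, and h = ∑ ε(h₁)h₂ = 0. -/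
theorem IsLeftInvariant.antipode_injective {φ : H →ₗ[k] k} (hφ : IsLeftInvariant k H φ)
    (h0 : φ ≠ 0) : Function.Injective (antipode k (A := H)) := by
  rw [injective_iff_map_eq_zero]
  intro h hh
  obtain ⟨n, p, q, e, hq⟩ := exists_sum_of_slice_eq_zero
    (fun a => φ ∘ₗ LinearMap.mulLeft k a ∘ₗ antipode k)
    (TensorProduct.comm k H H (comul (R := k) h)) fun a => by
      rw [← hφ.slice_mulRight_antipode, hh]
      have : φ ∘ₗ LinearMap.mulRight k (0 : H) = 0 := by
        ext b
        simp
      rw [this]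
      simp
  have hS (j) : antipode k (q j) = 0 := hφ.eq_zero_of_forall_mul_left h0 fun b => hq b j
  have e' : comul (R := k) h = ∑ j, q j ⊗ₜ[k] p j := by
    rw [← (TensorProduct.comm k H H).symm_apply_apply (comul (R := k) h), e]
    simp
  have h1 := rTensor_counit_comul (R := k) h
  rw [e'] at h1
  have h2 := congrArg (TensorProduct.lid k H) h1
  simp only [map_sum, LinearMap.rTensor_tmul, TensorProduct.lid_tmul, one_smul] at h2
  rw [← h2]
  refine Finset.sum_eq_zero fun j _ => ?_
  rw [← counit_antipode, hS]
  simp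

/-- The argument for the other radical, mirrored: injectivity of S removes it from
`slice_mulLeft_comul`, and ∑ a₂S⁻¹(a₁) = ε(a)1 replaces the antipode axiom. -/
theorem IsLeftInvariant.eq_zero_of_forall_mul_right {φ : H →ₗ[k] k} (hφ : IsLeftInvariant k H φ)
    (h0 : φ ≠ 0) {a : H} (ha : ∀ b, φ (a * b) = 0) : a = 0 := by
  obtain ⟨g, hg⟩ : ∃ g, φ g ≠ 0 := by
    by_contra! h
    exact h0 (LinearMap.ext h)
  have hinj := hφ.antipode_injective h0
  -- T is the inverse of S; only S(T(x)) = x is needed.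
  choose T hT using hφ.antipode_surjective h0
  have key (a : H) (ha : ∀ b, φ (a * b) = 0) : ∃ (n : ℕ) (p q : Fin n → H),
      comul (R := k) a = ∑ j, p j ⊗ₜ[k] q j ∧ ∀ i j, φ (q j * i) = 0 := by
    refine exists_sum_of_slice_eq_zero (fun c => φ ∘ₗ LinearMap.mulRight k c) _ fun c => hinj ?_
    have : φ ∘ₗ LinearMap.mulLeft k a = 0 := by
      ext b
      simp [ha]
    rw [← hφ.slice_mulLeft_comul, this, slice_zero]
    simp
  have hε (a : H) (ha : ∀ b, φ (a * b) = 0) : counit (R := k) a = 0 := by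
    obtain ⟨n, p, q, h, hq⟩ := key a ha
    have h1 := mul_antipode_lTensor_comul_apply (R := k) a
    rw [h] at h1
    have h3 : ∑ j, q j * T (p j) = counit (R := k) a • (1 : H) := by
      apply hinj
      simpa [antipode_mul_antidistrib, hT, Algebra.algebraMap_eq_smul_one] using h1
    have h2 := congrArg (fun x => φ (x * g)) h3
    simpa [Finset.sum_mul, mul_assoc, hq, hg] using h2.symm
  obtain ⟨n, p, q, h, hq⟩ := key a ha
  have h1 := slice_counit_comul (k := k) a
  rw [h] at h1
  rw [← h1]
  simp [hε _ (fun b => hq b _)]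

end Antipode

/-! ### Averages along an invariant functional are coinvariant. -/

section Comodule

variable {k : Type u} [Field k] {H : Type y} [Ring H] [HopfAlgebra k H]
  {V : Type x} [AddCommGroup V] [Module k V]

theorem IsComodule.slice_counit {δ : V →ₗ[k] V ⊗[k] H} (hδ : IsComodule δ) (t : V) :
    slice V (Coalgebra.counit (R := k)) (δ t) = t := hδ.counit t

/-- `v ↦ (id ⊗ φ) δ(v)` takes values in the coinvariants if `φ` is left invariant. -/
theorem IsComodule.coact_slice {δ : V →ₗ[k] V ⊗[k] H} (hδ : IsComodule δ) {φ : H →ₗ[k] k}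
    (hφ : IsLeftInvariant k H φ) (t : V) :
    δ (slice V φ (δ t)) = slice V φ (δ t) ⊗ₜ[k] (1 : H) := by
  have h1 : δ.rTensor H (δ t) = (TensorProduct.assoc k V H H).symm
      ((Coalgebra.comul (R := k) (A := H)).lTensor V (δ t)) := by
    rw [← hδ.coassoc, LinearEquiv.symm_apply_apply]
  rw [← slice_rTensor, h1]
  induction δ t using TensorProduct.induction_on with
  | zero => simp
  | tmul s h =>
    have : ∀ c : H ⊗[k] H, slice (V ⊗[k] H) φ ((TensorProduct.assoc k V H H).symm (s ⊗ₜ c)) =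
        s ⊗ₜ slice H φ c := by
      intro c
      induction c using TensorProduct.induction_on with
      | zero => simp
      | tmul => simp
      | add c d hc hd => simp only [TensorProduct.tmul_add, map_add, hc, hd]
    rw [LinearMap.lTensor_tmul, this, hφ.slice_comul, slice_tmul, TensorProduct.smul_tmul]
  | add a b ha hb => simp only [map_add, ha, hb, TensorProduct.add_tmul]

end Comodule

/-! ### The identities AA^α = A = A^αA and the local units. -/

section Galois

variable {k : Type u} [Field k] {H : Type y} [Ring H] [HopfAlgebra k H]
  {A : Type v} [NonUnitalRing A] [Module k A] [IsScalarTower k A A] [SMulCommClass k A A]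

theorem slice_tmul_one_mul_left (φ : H →ₗ[k] k) (c : A) (t : A ⊗[k] H) :
    slice A φ ((c ⊗ₜ[k] (1 : H)) * t) = c * slice A φ t := by
  induction t using TensorProduct.induction_on with
  | zero => simp
  | tmul => simp [mul_smul_comm]
  | add s t hs ht => simp [mul_add, hs, ht]

theorem slice_mul_tmul_one_right (φ : H →ₗ[k] k) (c : A) (t : A ⊗[k] H) :
    slice A φ (t * (c ⊗ₜ[k] (1 : H))) = slice A φ t * c := by
  induction t using TensorProduct.induction_on with
  | zero => simp
  | tmul => simp [smul_mul_assoc]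
  | add s t hs ht => simp [add_mul, hs, ht]

namespace Coaction

variable (α : Coaction k H A)

/-- `a ↦ (id ⊗ φ) α(a)`. -/
def average (φ : H →ₗ[k] k) : A →ₗ[k] A := slice A φ ∘ₗ (α.toHom : A →ₗ[k] A ⊗[k] H)

theorem average_apply (φ : H →ₗ[k] k) (a : A) : α.average φ a = slice A φ (α.toHom a) := rfl

variable {α}

theorem mem_coinvariants {a : A} : a ∈ α.coinvariants ↔ α.toHom a = a ⊗ₜ[k] (1 : H) := Iff.rfl

theorem average_mem {φ : H →ₗ[k] k} (hφ : IsLeftInvariant k H φ) (a : A) :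
    α.average φ a ∈ α.coinvariants :=
  α.isComodule.coact_slice hφ a

theorem IsGalois.preGaloisMap_surjective (h : α.IsGalois) :
    Function.Surjective α.preGaloisMap := by
  intro t
  obtain ⟨s, hs⟩ := h.2 t
  obtain ⟨r, rfl⟩ := Submodule.Quotient.mk_surjective _ s
  exact ⟨r, hs⟩

/-- The slice of (a ⊗ 1)α(b) along `φ` is aE(b), with E(b) coinvariant. -/
theorem slice_preGaloisMap_mem {φ : H →ₗ[k] k} (hφ : IsLeftInvariant k H φ) (s : A ⊗[k] A) :
    slice A φ (α.preGaloisMap s) ∈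
      Submodule.span k {r : A | ∃ a : A, ∃ c ∈ α.coinvariants, r = a * c} := by
  induction s using TensorProduct.induction_on with
  | zero => simp
  | tmul a b =>
    rw [preGaloisMap_tmul, slice_tmul_one_mul_left]
    exact Submodule.subset_span ⟨a, _, average_mem hφ b, rfl⟩
  | add s t hs ht => simpa only [map_add] using Submodule.add_mem _ hs ht

theorem span_mul_coinvariants {φ : H →ₗ[k] k} (hφ : IsLeftInvariant k H φ) (h0 : φ ≠ 0)
    (hα : Function.Surjective α.preGaloisMap) :
    Submodule.span k {r : A | ∃ a : A, ∃ c ∈ α.coinvariants, r = a * c} = ⊤ := by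
  obtain ⟨g, hg⟩ : ∃ g, φ g ≠ 0 := by
    by_contra! h
    exact h0 (LinearMap.ext h)
  refine eq_top_iff.2 fun a _ => ?_
  obtain ⟨s, hs⟩ := hα (((φ g)⁻¹ • a) ⊗ₜ g)
  have := slice_preGaloisMap_mem (α := α) hφ s
  rwa [hs, slice_tmul, smul_smul, mul_inv_cancel₀ hg, one_smul] at this

variable (α) in
/-- The linear map `A ⊗ H → A ⊗ H`, `a ⊗ h ↦ α(a) (1 ⊗ S(h))`. -/
def twist : A ⊗[k] H →ₗ[k] A ⊗[k] H :=
  (LinearMap.mul' k H).lTensor A ∘ₗ (TensorProduct.assoc k A H H).toLinearMap ∘ₗ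
    TensorProduct.map (α.toHom : A →ₗ[k] A ⊗[k] H) (HopfAlgebra.antipode k)

theorem lTensor_mul'_assoc_mul (s t : A ⊗[k] H) (g : H) :
    (LinearMap.mul' k H).lTensor A (TensorProduct.assoc k A H H ((s * t) ⊗ₜ g)) =
      s * (LinearMap.mul' k H).lTensor A (TensorProduct.assoc k A H H (t ⊗ₜ g)) := by
  induction s using TensorProduct.induction_on with
  | zero => simp
  | add s r hs hr => simp only [add_mul, TensorProduct.add_tmul, map_add, hs, hr]
  | tmul a h =>
    induction t using TensorProduct.induction_on with
    | zero => simp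
    | add s r hs hr => simp only [mul_add, TensorProduct.add_tmul, map_add, hs, hr]
    | tmul b h' => simp [mul_assoc]

theorem twist_tmul_one_mul (a : A) (t : A ⊗[k] H) :
    α.twist ((a ⊗ₜ[k] (1 : H)) * t) = α.toHom a * α.twist t := by
  induction t using TensorProduct.induction_on with
  | zero => simp
  | add s r hs hr => simp only [mul_add, map_add, hs, hr]
  | tmul b h =>
    rw [Algebra.TensorProduct.tmul_mul_tmul, one_mul]
    change (LinearMap.mul' k H).lTensor A (TensorProduct.assoc k A H H
      (α.toHom (a * b) ⊗ₜ HopfAlgebra.antipode k h)) = _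
    rw [map_mul, lTensor_mul'_assoc_mul]
    rfl

/-- By coassociativity the left side is ∑ b₀ ⊗ b₁S(b₂), which the antipode and counit axioms reduce.
-/
theorem twist_toHom (b : A) : α.twist (α.toHom b) = b ⊗ₜ[k] (1 : H) := by
  have h1 : ∀ t : A ⊗[k] H, α.twist t =
      (LinearMap.mul' k H ∘ₗ (HopfAlgebra.antipode k).lTensor H).lTensor A
        (TensorProduct.assoc k A H H ((α.toHom : A →ₗ[k] A ⊗[k] H).rTensor H t)) := by
    intro t
    induction t using TensorProduct.induction_on with
    | zero => simp
    | add s r hs hr => simp only [map_add, hs, hr]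
    | tmul a h =>
      change (LinearMap.mul' k H).lTensor A (TensorProduct.assoc k A H H
        (α.toHom a ⊗ₜ HopfAlgebra.antipode k h)) = _
      simp only [LinearMap.rTensor_tmul, LinearMap.coe_coe]
      induction α.toHom a using TensorProduct.induction_on with
      | zero => simp
      | add s r hs hr => simp only [TensorProduct.add_tmul, map_add, hs, hr]
      | tmul c g => simp
  have h2 := α.isComodule.coassoc b
  have h3 := α.isComodule.slice_counit b
  simp only [LinearMap.coe_coe] at h2 h3
  rw [h1, h2]
  conv_rhs => rw [← h3]
  induction α.toHom b using TensorProduct.induction_on with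
  | zero => simp
  | add s r hs hr => simp only [map_add, hs, hr, TensorProduct.add_tmul]
  | tmul c g =>
    simp [Algebra.algebraMap_eq_smul_one, TensorProduct.smul_tmul]

/-- The twist turns (a ⊗ 1)α(b) into α(a)(b ⊗ 1), which moves the averaged factor to the left: the
slice is E(a)b. -/
theorem slice_twist_preGaloisMap_mem {φ : H →ₗ[k] k} (hφ : IsLeftInvariant k H φ)
    (s : A ⊗[k] A) :
    slice A φ (α.twist (α.preGaloisMap s)) ∈
      Submodule.span k {r : A | ∃ a : A, ∃ c ∈ α.coinvariants, r = c * a} := by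
  induction s using TensorProduct.induction_on with
  | zero => simp
  | tmul a b =>
    rw [preGaloisMap_tmul, twist_tmul_one_mul, twist_toHom, slice_mul_tmul_one_right]
    exact Submodule.subset_span ⟨b, _, average_mem hφ a, rfl⟩
  | add s t hs ht => simpa only [map_add] using Submodule.add_mem _ hs ht

theorem span_coinvariants_mul {φ : H →ₗ[k] k} (hφ : IsLeftInvariant k H φ) (h0 : φ ≠ 0)
    (hα : Function.Surjective α.preGaloisMap) :
    Submodule.span k {r : A | ∃ a : A, ∃ c ∈ α.coinvariants, r = c * a} = ⊤ := by
  refine eq_top_iff.2 fun a _ => ?_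
  -- The element g is chosen so that φ(· S(g)) equals ε on the legs of α(a). The slice of twist(a ⊗
  -- g) = α(a)(1 ⊗ S(g)) is then a itself.
  obtain ⟨g, hg⟩ := exists_slice_eq
    (LinearMap.compr₂ (LinearMap.mul k H).flip φ ∘ₗ HopfAlgebra.antipode k) (fun c hc => by
      refine hφ.eq_zero_of_forall_mul_right h0 fun b => ?_
      obtain ⟨b, rfl⟩ := hφ.antipode_surjective h0 b
      exact hc b) (Coalgebra.counit (R := k)) (α.toHom a)
  have h3 := α.isComodule.slice_counit a
  simp only [LinearMap.coe_coe] at h3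
  obtain ⟨s, hs⟩ := hα (a ⊗ₜ g)
  have := slice_twist_preGaloisMap_mem (α := α) hφ s
  rw [hs] at this
  have h4 : slice A φ (α.twist (a ⊗ₜ g)) = a := by
    refine Eq.trans ?_ (hg.trans h3)
    change slice A φ ((LinearMap.mul' k H).lTensor A (TensorProduct.assoc k A H H
      (α.toHom a ⊗ₜ HopfAlgebra.antipode k g))) = _
    induction α.toHom a using TensorProduct.induction_on with
    | zero => simp
    | add s r hs hr => simp only [TensorProduct.add_tmul, map_add, hs, hr]
    | tmul c h => simp
  rwa [h4] at this

theorem coinvariants_local_units {I : Type z} (f : α.coinvariants →ₙₐ[k] (I →₀ k))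
    (hf : Function.Bijective f) (s : Finset A) (hs : ∀ c ∈ s, c ∈ α.coinvariants) :
    ∃ e ∈ α.coinvariants, ∀ c ∈ s, e * c = c ∧ c * e = c := by
  classical
  -- The unit corresponds to the indicator function of the union of the supports.
  let U : Finset I := s.attach.biUnion fun c => (f ⟨c, hs c c.2⟩).support
  obtain ⟨e, he⟩ := hf.2 (Finsupp.indicator U fun _ _ => (1 : k))
  have key (c : A) (hc : c ∈ s) (i : I) : f e i = 1 ∨ f ⟨c, hs c hc⟩ i = 0 := by
    by_cases hi : i ∈ U
    · left
      rw [he, Finsupp.indicator_of_mem hi]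
    · right
      by_contra h
      exact hi (Finset.mem_biUnion.2 ⟨⟨c, hc⟩, Finset.mem_attach _ _, Finsupp.mem_support_iff.2 h⟩)
  refine ⟨e, e.2, fun c hc => ?_⟩
  have h1 : e * ⟨c, hs c hc⟩ = ⟨c, hs c hc⟩ := hf.1 <| by
    ext i
    rw [map_mul, Finsupp.mul_apply]
    rcases key c hc i with h | h <;> simp [h]
  have h2 : ⟨c, hs c hc⟩ * e = ⟨c, hs c hc⟩ := hf.1 <| by
    ext i
    rw [map_mul, Finsupp.mul_apply]
    rcases key c hc i with h | h <;> simp [h]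
  exact ⟨congrArg Subtype.val h1, congrArg Subtype.val h2⟩

/-- Each a is a finite sum of products ca' and also of products a'c. An element that is a two-sided
unit for all coinvariants c occurring is therefore one for a, and finitely many coinvariants have a
common unit. -/
theorem hasCoinvariantLocalUnits_of_span {I : Type z} (f : α.coinvariants →ₙₐ[k] (I →₀ k))
    (hf : Function.Bijective f)
    (hr : Submodule.span k {r : A | ∃ a : A, ∃ c ∈ α.coinvariants, r = a * c} = ⊤)
    (hl : Submodule.span k {r : A | ∃ a : A, ∃ c ∈ α.coinvariants, r = c * a} = ⊤) :
    α.HasCoinvariantLocalUnits := by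
  classical
  have key (a : A) : ∃ s : Finset A, (∀ c ∈ s, c ∈ α.coinvariants) ∧
      ∀ e, (∀ c ∈ s, e * c = c ∧ c * e = c) → e * a = a ∧ a * e = a := by
    have h1 : ∃ s : Finset A, (∀ c ∈ s, c ∈ α.coinvariants) ∧
        ∀ e, (∀ c ∈ s, e * c = c ∧ c * e = c) → e * a = a := by
      have ha : a ∈ Submodule.span k {r : A | ∃ a : A, ∃ c ∈ α.coinvariants, r = c * a} := by
        rw [hl]; trivial
      induction ha using Submodule.span_induction with
      | mem r h =>
        obtain ⟨a, c, hc, rfl⟩ := h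
        refine ⟨{c}, by simpa using hc, fun e he => ?_⟩
        rw [← mul_assoc, (he c (by simp)).1]
      | zero => exact ⟨∅, by simp, by simp⟩
      | add x y _ _ hx hy =>
        obtain ⟨s, hs, hs'⟩ := hx
        obtain ⟨t, ht, ht'⟩ := hy
        refine ⟨s ∪ t, fun c hc => (Finset.mem_union.1 hc).elim (hs c) (ht c), fun e he => ?_⟩
        rw [mul_add, hs' e fun c hc => he c (Finset.mem_union_left _ hc),
          ht' e fun c hc => he c (Finset.mem_union_right _ hc)]
      | smul r x _ hx =>
        obtain ⟨s, hs, hs'⟩ := hx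
        exact ⟨s, hs, fun e he => by rw [mul_smul_comm, hs' e he]⟩
    have h2 : ∃ s : Finset A, (∀ c ∈ s, c ∈ α.coinvariants) ∧
        ∀ e, (∀ c ∈ s, e * c = c ∧ c * e = c) → a * e = a := by
      clear h1
      have ha : a ∈ Submodule.span k {r : A | ∃ a : A, ∃ c ∈ α.coinvariants, r = a * c} := by
        rw [hr]; trivial
      induction ha using Submodule.span_induction with
      | mem r h =>
        obtain ⟨a, c, hc, rfl⟩ := h
        refine ⟨{c}, by simpa using hc, fun e he => ?_⟩
        rw [mul_assoc, (he c (by simp)).2]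
      | zero => exact ⟨∅, by simp, by simp⟩
      | add x y _ _ hx hy =>
        obtain ⟨s, hs, hs'⟩ := hx
        obtain ⟨t, ht, ht'⟩ := hy
        refine ⟨s ∪ t, fun c hc => (Finset.mem_union.1 hc).elim (hs c) (ht c), fun e he => ?_⟩
        rw [add_mul, hs' e fun c hc => he c (Finset.mem_union_left _ hc),
          ht' e fun c hc => he c (Finset.mem_union_right _ hc)]
      | smul r x _ hx =>
        obtain ⟨s, hs, hs'⟩ := hx
        exact ⟨s, hs, fun e he => by rw [smul_mul_assoc, hs' e he]⟩
    obtain ⟨s, hs, hs'⟩ := h1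
    obtain ⟨t, ht, ht'⟩ := h2
    exact ⟨s ∪ t, fun c hc => (Finset.mem_union.1 hc).elim (hs c) (ht c), fun e he =>
      ⟨hs' e fun c hc => he c (Finset.mem_union_left _ hc),
        ht' e fun c hc => he c (Finset.mem_union_right _ hc)⟩⟩
  choose u hu hu' using key
  intro s
  obtain ⟨e, he, h⟩ := coinvariants_local_units f hf (s.biUnion u) fun c hc => by
    obtain ⟨a, -, hc⟩ := Finset.mem_biUnion.1 hc
    exact hu a c hc
  exact ⟨e, he, fun a ha => hu' a e fun c hc => h c (Finset.mem_biUnion.2 ⟨a, ha, hc⟩)⟩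

end Coaction

end Galois

/-! ### Averaging in equivariant modules, weight vectors and absolute simplicity. -/

section Averaging

variable {k : Type u} [Field k] {H : Type y} [Ring H] [HopfAlgebra k H]
  {A : Type v} [NonUnitalRing A] [Module k A] [IsScalarTower k A A] [SMulCommClass k A A]

theorem slice_tensorAct_tmul {A : Type v} [NonUnitalRing A] [Module k A]
    {V : Type x} [AddCommGroup V] [Module k V] (φ : H →ₗ[k] k)
    (act : A →ₗ[k] V →ₗ[k] V) (a : A) (g : H) (t : V ⊗[k] H) :
    slice V φ (tensorAct H act (a ⊗ₜ g) t) = act a (slice V (φ ∘ₗ LinearMap.mulLeft k g) t) := by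
  induction t using TensorProduct.induction_on with
  | zero => simp
  | tmul s h => simp [tensorAct_tmul]
  | add s t hs ht => simp only [map_add, hs, ht]

theorem slice_tensorAct_tmul_one {A : Type v} [NonUnitalRing A] [Module k A]
    {V : Type x} [AddCommGroup V] [Module k V] (φ : H →ₗ[k] k)
    (act : A →ₗ[k] V →ₗ[k] V) (a : A) (t : V ⊗[k] H) :
    slice V φ (tensorAct H act (a ⊗ₜ 1) t) = act a (slice V φ t) := by
  rw [slice_tensorAct_tmul]
  congr 3
  ext
  simp

theorem tensorAct_mul {V : Type x} [AddCommGroup V] [Module k V]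
    (act : A →ₙₐ[k] Module.End k V) (r s : A ⊗[k] H) (t : V ⊗[k] H) :
    tensorAct H (act : A →ₗ[k] Module.End k V) (r * s) t =
      tensorAct H (act : A →ₗ[k] Module.End k V) r
        (tensorAct H (act : A →ₗ[k] Module.End k V) s t) := by
  induction t using TensorProduct.induction_on with
  | zero => simp
  | add t t' ht ht' => simp only [map_add, ht, ht']
  | tmul b h =>
    induction s using TensorProduct.induction_on with
    | zero => simp
    | add t t' ht ht' => simp only [map_add, mul_add, LinearMap.add_apply, ht, ht']
    | tmul c h' =>
      induction r using TensorProduct.induction_on with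
      | zero => simp
      | add t t' ht ht' => simp only [map_add, add_mul, LinearMap.add_apply, ht, ht']
      | tmul d h'' => simp [tensorAct_tmul, mul_assoc]

/-- A criterion for simplicity in terms of the slices of the coaction along a functional. -/
theorem IsEquivariantlySimple.of_slice {K : Type w} [Field K] {A H V : Type*} [AddCommGroup A]
    [Module K A] [AddCommGroup H] [Module K H] [AddCommGroup V] [Module K V]
    {act : A →ₗ[K] V →ₗ[K] V} {δ : V →ₗ[K] V ⊗[K] H} (θ : H →ₗ[K] K) (h : ∃ a t, act a t ≠ 0)
    (hW : ∀ W : Submodule K V, (∀ a, ∀ t ∈ W, act a t ∈ W) →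
      (∀ t ∈ W, slice V θ (δ t) ∈ W) → W = ⊥ ∨ W = ⊤) : IsEquivariantlySimple act δ := by
  refine ⟨h, fun W hact hcoact => hW W hact fun t ht => ?_⟩
  obtain ⟨r, hr⟩ := hcoact t ht
  rw [← hr, slice_rTensor]
  exact (slice W θ r).2

namespace EquivariantModule

variable {α : Coaction k H A} {V : Type x} [AddCommGroup V] [Module k V]
  (M : EquivariantModule α V)

/-- `v ↦ (id ⊗ φ) δ(v)`. -/
def average (φ : H →ₗ[k] k) : V →ₗ[k] V := slice V φ ∘ₗ M.coact

theorem average_apply (φ : H →ₗ[k] k) (t : V) : M.average φ t = slice V φ (M.coact t) := rfl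

/-- By equivariance (a ⊗ 1)α(b)δ(t) = (a ⊗ 1)δ(bt), whose slice is aE(bt). -/
theorem slice_tensorAct_preGaloisMap_mem (φ : H →ₗ[k] k) (s : A ⊗[k] A) (t : V) :
    slice V φ (tensorAct H (M.act : A →ₗ[k] Module.End k V) (α.preGaloisMap s) (M.coact t)) ∈
      Submodule.span k {r : V | ∃ a b : A, r = M.act a (M.average φ (M.act b t))} := by
  induction s using TensorProduct.induction_on with
  | zero => simp
  | add s s' hs hs' => simpa only [map_add, LinearMap.add_apply] using Submodule.add_mem _ hs hs'
  | tmul a b =>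
    rw [Coaction.preGaloisMap_tmul, tensorAct_mul, ← M.equivariant, slice_tensorAct_tmul_one]
    exact Submodule.subset_span ⟨a, b, rfl⟩

/-- If φ(g ·) equals ε on the legs of δ(t), then the slice of (a ⊗ g)δ(t) is at, and a ⊗ g lies in
the image of the Galois map. -/
theorem act_mem_span {φ : H →ₗ[k] k} (hφ : IsLeftInvariant k H φ) (h0 : φ ≠ 0)
    (hα : Function.Surjective α.preGaloisMap) (a : A) (t : V) :
    M.act a t ∈
      Submodule.span k {r : V | ∃ a b : A, r = M.act a (M.average φ (M.act b t))} := by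
  obtain ⟨g, hg⟩ := exists_slice_eq (LinearMap.compr₂ (LinearMap.mul k H) φ)
    (fun c hc => hφ.eq_zero_of_forall_mul_left h0 hc) (Coalgebra.counit (R := k)) (M.coact t)
  rw [M.isComodule.slice_counit] at hg
  obtain ⟨s, hs⟩ := hα (a ⊗ₜ g)
  have := M.slice_tensorAct_preGaloisMap_mem φ s t
  rw [hs, slice_tensorAct_tmul] at this
  rw [show slice V (φ ∘ₗ LinearMap.mulLeft k g) (M.coact t) = t from hg] at this
  exact this

theorem act_eq_zero_of_average_eq_zero {φ : H →ₗ[k] k} (hφ : IsLeftInvariant k H φ) (h0 : φ ≠ 0)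
    (hα : Function.Surjective α.preGaloisMap) {t : V}
    (ht : ∀ b, M.average φ (M.act b t) = 0) (a : A) : M.act a t = 0 := by
  have h := M.act_mem_span hφ h0 hα a t
  rw [← Submodule.mem_bot k]
  refine Submodule.span_le.2 ?_ h
  rintro _ ⟨a, b, rfl⟩
  simp [ht]

/-- A local unit for the algebra elements in an expression t = ∑ aᵢvᵢ fixes t. -/
theorem exists_act_eq_self (hM : M.IsUnital) (hU : α.HasCoinvariantLocalUnits) (t : V) :
    ∃ e ∈ α.coinvariants, M.act e t = t := by
  classical
  have key : ∃ s : Finset A, ∀ e, (∀ a ∈ s, e * a = a) → M.act e t = t := by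
    have ht : t ∈ Submodule.span k {r : V | ∃ (a : A) (t : V), r = M.act a t} := by
      rw [hM]; trivial
    induction ht using Submodule.span_induction with
    | mem r h =>
      obtain ⟨a, t, rfl⟩ := h
      refine ⟨{a}, fun e he => ?_⟩
      rw [← Module.End.mul_apply, ← map_mul, he a (by simp)]
    | zero => exact ⟨∅, by simp⟩
    | add x y _ _ hx hy =>
      obtain ⟨s, hs⟩ := hx
      obtain ⟨t, ht⟩ := hy
      refine ⟨s ∪ t, fun e he => ?_⟩
      rw [map_add, hs e fun c hc => he c (Finset.mem_union_left _ hc),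
        ht e fun c hc => he c (Finset.mem_union_right _ hc)]
    | smul r x _ hx =>
      obtain ⟨s, hs⟩ := hx
      exact ⟨s, fun e he => by rw [map_smul, hs e he]⟩
  obtain ⟨s, hs⟩ := key
  obtain ⟨e, he, h⟩ := hU s
  exact ⟨e, he, hs e fun a ha => (h a ha).1⟩

/-- A coinvariant vector that is a simultaneous eigenvector of the algebra of coinvariants. -/
structure IsWeightVector (t : V) : Prop where
  coact_eq : M.coact t = t ⊗ₜ[k] (1 : H)
  act_mem : ∀ c ∈ α.coinvariants, M.act c t ∈ Submodule.span k {t}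

variable {M} in
theorem average_act_of_coact_eq {t : V} (ht : M.coact t = t ⊗ₜ[k] (1 : H)) (φ : H →ₗ[k] k)
    (a : A) : M.average φ (M.act a t) = M.act (α.average φ a) t := by
  rw [average_apply, M.equivariant, ht, Coaction.average_apply]
  induction α.toHom a using TensorProduct.induction_on with
  | zero => simp
  | add r s hr hs => simp only [map_add, LinearMap.add_apply, hr, hs]
  | tmul b h => simp [tensorAct_tmul]

variable {M} in
theorem IsWeightVector.average_mem {t : V} (ht : M.IsWeightVector t) {φ : H →ₗ[k] k}
    (hφ : IsLeftInvariant k H φ) (a : A) :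
    M.average φ (M.act a t) ∈ Submodule.span k {t} := by
  rw [average_act_of_coact_eq ht.coact_eq]
  exact ht.act_mem _ (Coaction.average_mem hφ a)

/-- Extension of scalars of a functional. -/
def baseChangeFunctional (K : Type w) [Field K] [Algebra k K] (φ : H →ₗ[k] k) :
    K ⊗[k] H →ₗ[K] K :=
  (TensorProduct.AlgebraTensorModule.rid k K K).toLinearMap ∘ₗ φ.baseChange K

theorem slice_baseChangeCoact (K : Type w) [Field K] [Algebra k K] (φ : H →ₗ[k] k)
    (δ : V →ₗ[k] V ⊗[k] H) (t : K ⊗[k] V) :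
    slice (K ⊗[k] V) (baseChangeFunctional K φ) (baseChangeCoact K δ t) =
      (slice V φ ∘ₗ δ).baseChange K t := by
  induction t using TensorProduct.induction_on with
  | zero => simp
  | add r s hr hs => simp only [map_add, hr, hs]
  | tmul c t =>
    simp only [baseChangeCoact, LinearMap.comp_apply, LinearMap.baseChange_tmul]
    induction δ t using TensorProduct.induction_on with
    | zero => simp
    | add r s hr hs => simp only [map_add, hr, hs, TensorProduct.tmul_add]
    | tmul p q => simp [baseChangeFunctional, TensorProduct.smul_tmul']

variable {M} in
/-- A unital equivariant module generated by a non-zero weight vector is absolutely simple. -/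
theorem IsWeightVector.isAbsolutelySimple {t : V} (ht : M.IsWeightVector t) (ht0 : t ≠ 0)
    (hgen : ∀ r, ∃ a, M.act a t = r) (hM : M.IsUnital) (hU : α.HasCoinvariantLocalUnits)
    {φ : H →ₗ[k] k} (hφ : IsLeftInvariant k H φ) (h0 : φ ≠ 0)
    (hα : Function.Surjective α.preGaloisMap) : IsAbsolutelySimple.{u, v, w} M := by
  intro K _ _
  refine IsEquivariantlySimple.of_slice (baseChangeFunctional K φ) ?_ fun W hact hcoact => ?_
  · obtain ⟨a, ha⟩ := hgen t
    refine ⟨1 ⊗ₜ a, 1 ⊗ₜ t, ?_⟩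
    rw [baseChangeAct_tmul]
    change (1 * 1 : K) ⊗ₜ[k] M.act a t ≠ 0
    rw [ha, mul_one]
    intro h
    exact ht0 (Module.FaithfullyFlat.tensorProduct_mk_injective (A := k) (B := K) V
      (by simpa using h))
  · have hW (s) (hs : s ∈ W) : (M.average φ).baseChange K s ∈ W := by
      have h := hcoact s hs
      rwa [slice_baseChangeCoact] at h
    have hactW (s) (hs : s ∈ W) (b : A) : (M.act b).baseChange K s ∈ W := by
      have := hact (1 ⊗ₜ b) s hs
      simpa [baseChangeAct] using this
    -- Either averaging kills AW, which forces W = 0, or W contains a non-zero multiple of 1 ⊗ t,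
    -- which generates everything.
    by_cases hz : ∀ s ∈ W, ∀ b : A, (M.average φ).baseChange K ((M.act b).baseChange K s) = 0
    · left
      rw [eq_bot_iff]
      intro s hs
      -- Expanding s along a basis of K over k reduces its vanishing to that of coefficients in V,
      -- where faithfulness of averaging is available.
      let b := Module.Basis.ofVectorSpace k K
      obtain ⟨c, rfl⟩ := TensorProduct.eq_repr_basis_left b s
      have hc (i) : c i = 0 := by
        have key (a : A) : M.average φ (M.act a (c i)) = 0 := by
          have h1 := hz _ hs a
          simp only [Finsupp.sum, map_sum, LinearMap.baseChange_tmul] at h1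
          have h2 := TensorProduct.sum_tmul_basis_left_eq_zero b
            (c.mapRange (M.average φ ∘ₗ M.act a) (map_zero _)) (by
              rw [Finsupp.sum_mapRange_index (by simp)]
              exact h1)
          exact DFunLike.congr_fun h2 i
        obtain ⟨e, -, he⟩ := M.exists_act_eq_self hM hU (c i)
        rw [← he]
        exact M.act_eq_zero_of_average_eq_zero hφ h0 hα key e
      simp [Finsupp.sum, hc]
    · right
      push Not at hz
      obtain ⟨s, hs, b, hb⟩ := hz
      have hline (r : K ⊗[k] V) : ∃ c : K, (M.average φ).baseChange K r = c ⊗ₜ t := by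
        induction r using TensorProduct.induction_on with
        | zero => exact ⟨0, by simp⟩
        | add p q hp hq =>
          obtain ⟨c, hc⟩ := hp
          obtain ⟨d, hd⟩ := hq
          exact ⟨c + d, by rw [map_add, hc, hd, TensorProduct.add_tmul]⟩
        | tmul c r =>
          obtain ⟨a, rfl⟩ := hgen r
          obtain ⟨d, hd⟩ := Submodule.mem_span_singleton.1 (ht.average_mem hφ a)
          exact ⟨d • c, by rw [LinearMap.baseChange_tmul, ← hd, TensorProduct.smul_tmul]⟩
      have hmem := hW _ (hactW s hs b)
      obtain ⟨c, hc⟩ := hline ((M.act b).baseChange K s)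
      rw [hc] at hb hmem
      have hc0 : c ≠ 0 := by
        rintro rfl
        simp at hb
      have hall (d : K) : d ⊗ₜ[k] t ∈ W := by
        have := W.smul_mem (d * c⁻¹) hmem
        rwa [TensorProduct.smul_tmul', smul_eq_mul, mul_assoc, inv_mul_cancel₀ hc0, mul_one] at this
      rw [eq_top_iff]
      intro r _
      induction r using TensorProduct.induction_on with
      | zero => exact W.zero_mem
      | add p q hp hq => exact W.add_mem (hp trivial) (hq trivial)
      | tmul d r =>
        obtain ⟨a, rfl⟩ := hgen r
        simpa using hactW _ (hall d) a

end EquivariantModule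

end Averaging

/-! ### Submodules generated by weight vectors and the direct sum decomposition. -/

section Decomposition

variable {k : Type u} [Field k] {H : Type y} [Ring H] [HopfAlgebra k H]

theorem rTensor_subtype_injective {V : Type x} [AddCommGroup V] [Module k V] (W : Submodule k V)
    (B : Type*) [AddCommGroup B] [Module k B] :
    Function.Injective (W.subtype.rTensor B) :=
  Module.Flat.rTensor_preserves_injective_linearMap _ W.injective_subtype

/-- The restriction of a coaction to a subcomodule. -/
def restrictCoact {V : Type x} [AddCommGroup V] [Module k V] (δ : V →ₗ[k] V ⊗[k] H)
    (W : Submodule k V) (hW : ∀ t ∈ W, δ t ∈ LinearMap.range (W.subtype.rTensor H)) :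
    W →ₗ[k] W ⊗[k] H :=
  (LinearEquiv.ofInjective _ (rTensor_subtype_injective W H)).symm.toLinearMap ∘ₗ
    (δ ∘ₗ W.subtype).codRestrict _ fun t => hW t t.2

theorem rTensor_restrictCoact {V : Type x} [AddCommGroup V] [Module k V] (δ : V →ₗ[k] V ⊗[k] H)
    (W : Submodule k V) (hW : ∀ t ∈ W, δ t ∈ LinearMap.range (W.subtype.rTensor H)) (t : W) :
    W.subtype.rTensor H (restrictCoact δ W hW t) = δ t := by
  have := LinearEquiv.apply_symm_apply (LinearEquiv.ofInjective _ (rTensor_subtype_injective W H))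
    ⟨δ t, hW t t.2⟩
  exact congrArg Subtype.val this

theorem IsComodule.restrictCoact {V : Type x} [AddCommGroup V] [Module k V]
    {δ : V →ₗ[k] V ⊗[k] H} (hδ : IsComodule δ)
    (W : Submodule k V) (hW : ∀ t ∈ W, δ t ∈ LinearMap.range (W.subtype.rTensor H)) :
    IsComodule (restrictCoact δ W hW) where
  coassoc t := by
    apply rTensor_subtype_injective W (H ⊗[k] H)
    have h1 (r : (W ⊗[k] H) ⊗[k] H) :
        W.subtype.rTensor (H ⊗[k] H) (TensorProduct.assoc k W H H r) =
          TensorProduct.assoc k V H H ((W.subtype.rTensor H).rTensor H r) := by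
      have : (W.subtype.rTensor (H ⊗[k] H)) ∘ₗ (TensorProduct.assoc k W H H).toLinearMap =
          (TensorProduct.assoc k V H H).toLinearMap ∘ₗ (W.subtype.rTensor H).rTensor H := by
        ext
        simp
      exact LinearMap.congr_fun this r
    have h2 : W.subtype.rTensor H ∘ₗ HopfGalois.restrictCoact δ W hW = δ ∘ₗ W.subtype :=
      LinearMap.ext (rTensor_restrictCoact δ W hW)
    have h3 (r : W ⊗[k] H) :
        (W.subtype.rTensor H).rTensor H ((HopfGalois.restrictCoact δ W hW).rTensor H r) =
          δ.rTensor H (W.subtype.rTensor H r) := by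
      rw [← LinearMap.rTensor_comp_apply, ← LinearMap.rTensor_comp_apply, h2]
    have h4 (r : W ⊗[k] H) :
        W.subtype.rTensor (H ⊗[k] H) ((Coalgebra.comul (R := k) (A := H)).lTensor W r) =
          (Coalgebra.comul (R := k) (A := H)).lTensor V (W.subtype.rTensor H r) := by
      rw [← LinearMap.comp_apply, ← LinearMap.comp_apply, LinearMap.rTensor_comp_lTensor,
        LinearMap.lTensor_comp_rTensor]
    rw [h1, h3, h4, rTensor_restrictCoact, hδ.coassoc]
  counit t := by
    apply W.injective_subtype
    change W.subtype (slice W _ _) = _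
    rw [← slice_rTensor, rTensor_restrictCoact, hδ.slice_counit]
    rfl

variable {A : Type v} [NonUnitalRing A] [Module k A] [IsScalarTower k A A] [SMulCommClass k A A]

namespace EquivariantModule

variable {α : Coaction k H A} {V : Type x} [AddCommGroup V] [Module k V]
  (M : EquivariantModule α V)

/-- The restriction of an equivariant module to an equivariant submodule. -/
def restrict (W : Submodule k V) (hact : ∀ a, ∀ t ∈ W, M.act a t ∈ W)
    (hcoact : ∀ t ∈ W, M.coact t ∈ LinearMap.range (W.subtype.rTensor H)) :
    EquivariantModule α W where
  act :=
    { toFun := fun a => (M.act a).restrict (hact a)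
      map_smul' := fun c a => by ext; simp
      map_zero' := by ext; simp
      map_add' := fun a b => by ext; simp
      map_mul' := fun a b => by ext; simp }
  coact := restrictCoact M.coact W hcoact
  isComodule := M.isComodule.restrictCoact W hcoact
  equivariant a t := by
    apply rTensor_subtype_injective W H
    rw [rTensor_restrictCoact]
    refine (M.equivariant a t).trans ?_
    rw [← rTensor_restrictCoact M.coact W hcoact]
    induction α.toHom a using TensorProduct.induction_on with
    | zero => simp
    | add r s hr hs => simp only [map_add, LinearMap.add_apply, hr, hs]
    | tmul b h =>
      induction restrictCoact M.coact W hcoact t using TensorProduct.induction_on with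
      | zero => simp
      | add r s hr hs => simp only [map_add, hr, hs]
      | tmul p q =>
        rw [LinearMap.rTensor_tmul, tensorAct_tmul, tensorAct_tmul, LinearMap.rTensor_tmul]
        rfl

/-- The submodule `At` generated by a vector `t`. -/
def cyclic (t : V) : Submodule k V :=
  LinearMap.range ((M.act : A →ₗ[k] Module.End k V).flip t)

theorem act_mem_cyclic (t : V) (a : A) (r : V) (hr : r ∈ M.cyclic t) : M.act a r ∈ M.cyclic t := by
  obtain ⟨b, rfl⟩ := hr
  exact ⟨a * b, by simp⟩

variable {M} in
theorem coact_mem_cyclic {t : V} (ht : M.coact t = t ⊗ₜ[k] (1 : H)) (r : V)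
    (hr : r ∈ M.cyclic t) : M.coact r ∈ LinearMap.range ((M.cyclic t).subtype.rTensor H) := by
  obtain ⟨b, rfl⟩ := hr
  change M.coact (M.act b t) ∈ _
  rw [M.equivariant, ht]
  induction α.toHom b using TensorProduct.induction_on with
  | zero => simp
  | add r s hr hs => simpa only [map_add, LinearMap.add_apply] using Submodule.add_mem _ hr hs
  | tmul c h => exact ⟨⟨M.act c t, c, rfl⟩ ⊗ₜ h, by simp [tensorAct_tmul]⟩

/-- The equivariant submodule generated by a coinvariant vector. -/
def cyclicModule (t : V) (ht : M.coact t = t ⊗ₜ[k] (1 : H)) : EquivariantModule α (M.cyclic t) :=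
  M.restrict (M.cyclic t) (M.act_mem_cyclic t) (coact_mem_cyclic ht)

theorem cyclicModule_isAbsolutelySimple (hM : M.IsUnital) (hU : α.HasCoinvariantLocalUnits)
    {φ : H →ₗ[k] k} (hφ : IsLeftInvariant k H φ) (h0 : φ ≠ 0)
    (hα : Function.Surjective α.preGaloisMap) {t : V} (ht : M.IsWeightVector t) (ht0 : t ≠ 0) :
    IsAbsolutelySimple.{u, v, w} (M.cyclicModule t ht.coact_eq) := by
  have hunit (r : V) : ∃ e ∈ α.coinvariants, M.act e r = r := M.exists_act_eq_self hM hU r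
  obtain ⟨e, he, het⟩ := hunit t
  let t' : M.cyclic t := ⟨t, e, het⟩
  have hw : (M.cyclicModule t ht.coact_eq).IsWeightVector t' := by
    refine ⟨?_, fun c hc => ?_⟩
    · apply rTensor_subtype_injective (M.cyclic t) H
      exact (rTensor_restrictCoact _ _ (coact_mem_cyclic ht.coact_eq) _).trans ht.coact_eq
    · obtain ⟨d, hd⟩ := Submodule.mem_span_singleton.1 (ht.act_mem c hc)
      exact Submodule.mem_span_singleton.2 ⟨d, Subtype.ext hd⟩
  refine hw.isAbsolutelySimple (fun h => ht0 (congrArg Subtype.val h)) ?_ ?_ hU hφ h0 hα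
  · rintro ⟨r, a, rfl⟩
    exact ⟨a, rfl⟩
  · refine eq_top_iff.2 fun r _ => ?_
    obtain ⟨e, -, her⟩ := hunit r
    exact Submodule.subset_span ⟨e, r, Subtype.ext her.symm⟩

/-- Let pᵢ be the minimal idempotents of A^α ≅ k_I. Since cpᵢ = f(c)(i)pᵢ, each pᵢt is a weight
vector, and a coinvariant e with et = t is a finite combination of the pᵢ. -/
theorem mem_span_weightVectors {I : Type z} (f : α.coinvariants →ₙₐ[k] (I →₀ k))
    (hf : Function.Bijective f) (hM : M.IsUnital) (hU : α.HasCoinvariantLocalUnits)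
    {t : V} (ht : M.coact t = t ⊗ₜ[k] (1 : H)) :
    t ∈ Submodule.span k {r | M.IsWeightVector r} := by
  obtain ⟨e, he, het⟩ := M.exists_act_eq_self hM hU t
  choose p hp using fun i => hf.2 (Finsupp.single i (1 : k))
  have hmul (c : α.coinvariants) (i : I) : c * p i = f c i • p i := hf.1 <| by
    classical
    ext j
    rw [map_mul, Finsupp.mul_apply, map_smul, hp, Finsupp.smul_apply, Finsupp.single_apply]
    split_ifs with h <;> simp [h]
  have hw (i : I) : M.IsWeightVector (M.act (p i) t) := by
    refine ⟨?_, fun c hc => ?_⟩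
    · rw [M.equivariant, Coaction.mem_coinvariants.1 (p i).2, ht, tensorAct_tmul, one_mul]
      rfl
    · refine Submodule.mem_span_singleton.2 ⟨f ⟨c, hc⟩ i, ?_⟩
      rw [← Module.End.mul_apply, ← map_mul]
      have := congrArg Subtype.val (hmul ⟨c, hc⟩ i)
      simp only [NonUnitalSubalgebra.coe_mul, NonUnitalSubalgebra.coe_smul] at this
      rw [this, map_smul, LinearMap.smul_apply]
  have hsum : (⟨e, he⟩ : α.coinvariants) = ∑ i ∈ (f ⟨e, he⟩).support, f ⟨e, he⟩ i • p i := by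
    apply hf.1
    rw [map_sum]
    conv_lhs => rw [← Finsupp.sum_single (f ⟨e, he⟩)]
    refine Finset.sum_congr rfl fun i _ => ?_
    rw [map_smul, hp, Finsupp.smul_single, smul_eq_mul, mul_one]
  have hsum' := congrArg Subtype.val hsum
  rw [AddSubmonoidClass.coe_finsetSum] at hsum'
  simp only [NonUnitalSubalgebra.coe_smul] at hsum'
  rw [← het, hsum', map_sum, LinearMap.sum_apply]
  refine Submodule.sum_mem _ fun i _ => ?_
  rw [map_smul, LinearMap.smul_apply]
  exact Submodule.smul_mem _ _ (Submodule.subset_span (hw i))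

/-- The sum of the cyclic submodules generated by linearly independent weight vectors is
direct. -/
theorem coeLinearMap_cyclic_injective (hM : M.IsUnital) (hU : α.HasCoinvariantLocalUnits)
    {φ : H →ₗ[k] k} (hφ : IsLeftInvariant k H φ) (h0 : φ ≠ 0)
    (hα : Function.Surjective α.preGaloisMap) {b : Set V} [DecidableEq b]
    (hb : ∀ t ∈ b, M.IsWeightVector t)
    (hli : LinearIndependent k ((↑) : b → V)) :
    Function.Injective (DirectSum.coeLinearMap fun t : b => M.cyclic (t : V)) := by
  classical
  rw [injective_iff_map_eq_zero]
  intro s hs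
  rw [DirectSum.coeLinearMap_eq_dfinsuppSum, DFinsupp.sum] at hs
  ext t
  by_cases hmem : t ∈ DFinsupp.support s
  swap
  · simpa using hmem
  -- E(a ·) maps the component in each cyclic submodule Ar to the line kr, so the relation `hs`
  -- becomes a linear relation among the independent vectors r.
  have hz (a : A) : M.average φ (M.act a (s t)) = 0 := by
    have hline (r : b) : ∃ c : k, c • (r : V) = M.average φ (M.act a (s r)) := by
      obtain ⟨a', ha'⟩ := M.act_mem_cyclic r a _ (s r).2
      refine Submodule.mem_span_singleton.1 ?_
      rw [← ha']
      exact (hb r r.2).average_mem hφ a'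
    choose c hc using hline
    have h1 := congrArg (fun r => M.average φ (M.act a r)) hs
    simp only [map_sum, map_zero, ← hc] at h1
    rw [← hc, linearIndependent_iff'.1 hli _ _ h1 t hmem, zero_smul]
  obtain ⟨e, -, he⟩ := M.exists_act_eq_self hM hU (s t)
  rw [← he, M.act_eq_zero_of_average_eq_zero hφ h0 hα hz]
  rfl

/-- V = AV is spanned by vectors aE(ct), and the coinvariant E(ct) is a combination of weight
vectors, hence of elements of b. -/
theorem coeLinearMap_cyclic_surjective {I : Type z} (f : α.coinvariants →ₙₐ[k] (I →₀ k))
    (hf : Function.Bijective f) (hM : M.IsUnital) (hU : α.HasCoinvariantLocalUnits)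
    {φ : H →ₗ[k] k} (hφ : IsLeftInvariant k H φ) (h0 : φ ≠ 0)
    (hα : Function.Surjective α.preGaloisMap) {b : Set V} [DecidableEq b]
    (hspan : Submodule.span k b = Submodule.span k {r | M.IsWeightVector r}) :
    Function.Surjective (DirectSum.coeLinearMap fun t : b => M.cyclic (t : V)) := by
  rw [← LinearMap.range_eq_top, eq_top_iff, ← hM, Submodule.span_le]
  rintro _ ⟨a, t, rfl⟩
  refine Submodule.span_le.2 ?_ (M.act_mem_span hφ h0 hα a t)
  rintro _ ⟨a, c, rfl⟩
  have h1 := M.mem_span_weightVectors f hf hM hU (M.isComodule.coact_slice hφ (M.act c t))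
  rw [← hspan] at h1
  change M.act a (slice V φ (M.coact (M.act c t))) ∈ LinearMap.range _
  generalize slice V φ (M.coact (M.act c t)) = r at h1
  induction h1 using Submodule.span_induction with
  | mem r hr =>
    exact ⟨DirectSum.lof k b (fun t => M.cyclic (t : V)) ⟨r, hr⟩ ⟨M.act a r, a, rfl⟩, by
      rw [DirectSum.coeLinearMap_lof]⟩
  | zero => simp
  | add r s _ _ hr hs => simpa only [map_add] using Submodule.add_mem _ hr hs
  | smul d r _ hr => simpa only [map_smul] using Submodule.smul_mem _ d hr

/-- The projections of a direct sum of equivariant submodules are morphisms. -/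
theorem isHom_component {ι : Type w} [DecidableEq ι] (p : ι → Submodule k V)
    (hact : ∀ i a, ∀ t ∈ p i, M.act a t ∈ p i)
    (hcoact : ∀ i, ∀ t ∈ p i, M.coact t ∈ LinearMap.range ((p i).subtype.rTensor H))
    (hp : Function.Bijective (DirectSum.coeLinearMap p)) (i : ι) :
    IsHom M (M.restrict (p i) (hact i) (hcoact i)) (DirectSum.component k ι (fun i => p i) i ∘ₗ
      (LinearEquiv.ofBijective (DirectSum.coeLinearMap p) hp).symm.toLinearMap) := by
  set e := LinearEquiv.ofBijective (DirectSum.coeLinearMap p) hp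
  set π := DirectSum.component k ι (fun i => p i) i ∘ₗ e.symm.toLinearMap with hπ
  have he (j : ι) (r : p j) : e.symm r = DirectSum.lof k ι (fun i => p i) j r := by
    rw [LinearEquiv.symm_apply_eq]
    exact (DirectSum.coeLinearMap_lof p j r).symm
  have hself (r : p i) : π r = r := by
    rw [hπ, LinearMap.comp_apply, LinearEquiv.coe_coe, he, DirectSum.component.of, dif_pos rfl]
  have hne (j : ι) (hj : j ≠ i) (r : p j) : π r = 0 := by
    rw [hπ, LinearMap.comp_apply, LinearEquiv.coe_coe, he, DirectSum.component.of, dif_neg hj]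
  have hself' : π ∘ₗ (p i).subtype = LinearMap.id := LinearMap.ext hself
  have hne' (j : ι) (hj : j ≠ i) : π ∘ₗ (p j).subtype = 0 := LinearMap.ext (hne j hj)
  -- Additive properties need checking only on the summands, where the projection is the identity or
  -- zero.
  have hind {P : V → Prop} (h0 : P 0) (hadd : ∀ s t, P s → P t → P (s + t))
      (hmem : ∀ j (r : p j), P r) (t : V) : P t := by
    obtain ⟨s, rfl⟩ := hp.2 t
    induction s using DirectSum.induction_on with
    | zero => simpa using h0
    | of j r => simpa using hmem j r
    | add s t hs ht => simpa using hadd _ _ hs ht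
  constructor
  · intro a
    refine hind (by simp) (fun s t hs ht => by simp only [map_add, hs, ht]) fun j r => ?_
    by_cases hj : j = i
    · subst hj
      rw [hself, hself ⟨M.act a r, hact j a r r.2⟩]
      rfl
    · rw [hne j hj, hne j hj ⟨M.act a r, hact j a r r.2⟩, map_zero]
  · refine hind (by simp) (fun s t hs ht => by simp only [map_add, hs, ht]) fun j r => ?_
    rw [← rTensor_restrictCoact M.coact (p j) (hcoact j), ← LinearMap.rTensor_comp_apply]
    by_cases hj : j = i
    · subst hj
      rw [hself, hself', LinearMap.rTensor_id]
      rfl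
    · rw [hne j hj, hne' j hj, LinearMap.rTensor_zero, map_zero, LinearMap.zero_apply]

theorem isAbsolutelySemisimple {I : Type z} (f : α.coinvariants →ₙₐ[k] (I →₀ k))
    (hf : Function.Bijective f) (hM : M.IsUnital) (hU : α.HasCoinvariantLocalUnits)
    {φ : H →ₗ[k] k} (hφ : IsLeftInvariant k H φ) (h0 : φ ≠ 0)
    (hα : Function.Surjective α.preGaloisMap) : IsAbsolutelySemisimple.{u, v, w} M := by
  classical
  -- The index set of the decomposition is a basis, made of weight vectors, of the span of all
  -- weight vectors.
  obtain ⟨b, hb, hspan, hli⟩ := exists_linearIndependent k {r | M.IsWeightVector r}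
  have hbij := And.intro (M.coeLinearMap_cyclic_injective hM hU hφ h0 hα hb hli)
    (M.coeLinearMap_cyclic_surjective f hf hM hU hφ h0 hα hspan)
  exact ⟨b, fun t => M.cyclic (t : V), inferInstance, inferInstance,
    fun t => M.cyclicModule t (hb t.2).coact_eq, (LinearEquiv.ofBijective _ hbij).symm,
    fun t => M.cyclicModule_isAbsolutelySimple hM hU hφ h0 hα (hb t.2) (hli.ne_zero t),
    fun t => M.isHom_component (fun t : b => M.cyclic (t : V))
      (fun t => M.act_mem_cyclic t) (fun t => coact_mem_cyclic (hb t.2).coact_eq) hbij t⟩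

end EquivariantModule

end Decomposition

end HopfGalois

end

theorem mainTheorem7 {k : Type u} [Field k] {H : Type y} [Ring H] [HopfAlgebra k H]
    (hH : HopfGalois.HasInvariantFunctionals k H)
    {A : Type v} [NonUnitalRing A] [Module k A] [IsScalarTower k A A] [SMulCommClass k A A]
    (I : Type z) (α : HopfGalois.Coaction k H A) (hα : α.IsGaloisObject I) :
    Submodule.span k {r : A | ∃ a : A, ∃ c ∈ α.coinvariants, r = a * c} = ⊤ ∧
    Submodule.span k {r : A | ∃ a : A, ∃ c ∈ α.coinvariants, r = c * a} = ⊤ ∧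
    α.HasCoinvariantLocalUnits ∧
    HopfGalois.Coaction.IsEquivariantlyAbsolutelySemisimple.{u, v, w, x, y} α := by
  obtain ⟨⟨φ, h0, hφ⟩, -⟩ := hH
  obtain ⟨hgal, f, hf⟩ := hα
  have hsurj := hgal.preGaloisMap_surjective
  have hr := HopfGalois.Coaction.span_mul_coinvariants hφ h0 hsurj
  have hl := HopfGalois.Coaction.span_coinvariants_mul hφ h0 hsurj
  have hU := HopfGalois.Coaction.hasCoinvariantLocalUnits_of_span f hf hr hl
  exact ⟨hr, hl, hU, fun V _ _ M hM => M.isAbsolutelySemisimple f hf hM hU hφ h0 hsurj⟩
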